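/- Let $\rho(z+wj)=\begin{pmatrix} z&-\overline w\\ w&\overline z\end{pmatrix}$ for $z,w\in\mathbb C=\mathbb R+i\mathbb R\subset\mathbb H$. Let $\mathrm{GL}(2,\mathbb H)$ be the group of invertible complex $4\times4$ matrices $\begin{pmatrix}A&B\\C&D\end{pmatrix}$ with $A,B,C,D\in\rho(\mathbb H)$, and let $\mathrm{PGL}(2,\mathbb H)=\mathrm{GL}(2,\mathbb H)/\mathbb R^\times$. It acts on $\mathbb P(\Lambda^2\mathbb C^4)\cong\mathbb{CP}^5$ through $T\mapsto\Lambda^2T$, and on the dual projective space (the space of hyperplanes) through the contragredient representation. Use homogeneous coordinates $[\zeta_1:\dots:\zeta_6]$ with respect to the basis $e_3\wedge e_4,\ -e_2\wedge e_4,\ e_2\wedge e_3,\ e_1\wedge e_4,\ -e_1\wedge e_3,\ e_1\wedge e_2$ of $\Lambda^2\mathbb C^4$, so that the Klein quadric is $Q=\{q=0\}$ with $q(\zeta)=\zeta_1\zeta_6-\zeta_2\zeta_5+\zeta_3\zeta_4$. **Theorem.** Every $\mathrm{PGL}(2,\mathbb H)$-orbit in $\mathbb P(\Lambda^2\mathbb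 C^4)$ is the orbit of exactly one of the following points: - real null: $[0:0:0:0:0:1]$; - non-real isotropic: $[-1:0:-i:i:0:1]$; - real time-like: $[1:0:0:0:0:1]$; - real space-like: $[1:0:0:0:0:-1]$; - non-real degenerate: $[0:0:-i:i:0:1]$; - non-real Lorentzian: $p_\theta=[e^{i\theta}:0:0:0:0:1]$, for one $\theta$ with $0<\theta<\pi$; - non-real negative-definite: $p_\lambda=[1:0:-i\lambda:i\lambda:0:-1]$, for one $\lambda$ with $0<\lambda<1$. Dually, the polarity $\kappa([z_1:\dots:z_6])=[z_6:-z_5:z_4:z_3:-z_2:z_1]$ (the point $[z]$ is sent to the hyperplane $B(z,\cdot)=0$, where $B(z,\eta)=q(z+\eta)-q(z)-q(\eta)$) is a $\mathrm{PGL}(2,\mathbb H)$-equivariant bijection from $\mathbb P(\Lambda^2\mathbb C^4)$ onto the dual projective space. Hence every orbit of hyperplanes is the orbit of $\kappa(p)$ for exactly one $p$ in the list, and every hyperplane section $Q\cap\Pi$ of the Klein quadric is carried by some element of $\mathrm{PGL}(2,\mathbb H)$ onto $Q\cap\kappa(p)$ for exactly one $p$ in the list. -/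

import Mathlib

open scoped LinearAlgebra.Projectivization Quaternion

noncomputable section

namespace TwistorOrbits

/-! ### The group `PGL(2, ℍ)` -/

/-- The complex realization `z + w j ↦ !![z, -w̄; w, z̄]` of a quaternion
`a + b i + c j + d k = (a + b i) + (c + d i) j`. -/
def quatMatrix (q : ℍ[ℝ]) : Matrix (Fin 2) (Fin 2) ℂ :=
  !![(⟨q.re, q.imI⟩ : ℂ), -(starRingEnd ℂ) ⟨q.imJ, q.imK⟩;
     (⟨q.imJ, q.imK⟩ : ℂ), (starRingEnd ℂ) ⟨q.re, q.imI⟩]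

/-- The `(a, b)` block, of size `2 × 2`, of a complex `4 × 4` matrix, for the decomposition
`ℂ⁴ = ℂ² ⊕ ℂ²` into the first two and the last two coordinates. -/
def block (T : Matrix (Fin 4) (Fin 4) ℂ) (a b : Fin 2) : Matrix (Fin 2) (Fin 2) ℂ :=
  Matrix.of fun i j => T (finProdFinEquiv (a, i)) (finProdFinEquiv (b, j))

/-- The matrix of the antilinear map `(Z₁, Z₂, Z₃, Z₄) ↦ (-Z̄₂, Z̄₁, -Z̄₄, Z̄₃)`. -/
def jMatrix : Matrix (Fin 4) (Fin 4) ℂ :=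
  !![0, -1, 0, 0; 1, 0, 0, 0; 0, 0, 0, -1; 0, 0, 1, 0]

/-- The blocks of `T` are quaternions if and only if `T` commutes with the antilinear map. -/
theorem block_mem_iff (T : Matrix (Fin 4) (Fin 4) ℂ) :
    (∀ a b, block T a b ∈ Set.range quatMatrix) ↔
      T * jMatrix = jMatrix * T.map (starRingEnd ℂ) := by
  have key : ∀ M : Matrix (Fin 2) (Fin 2) ℂ, M ∈ Set.range quatMatrix ↔
      M 0 1 = -(starRingEnd ℂ) (M 1 0) ∧ M 1 1 = (starRingEnd ℂ) (M 0 0) := by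
    intro M
    constructor
    · rintro ⟨q, rfl⟩
      simp [quatMatrix]
    · rintro ⟨h1, h2⟩
      refine ⟨⟨(M 0 0).re, (M 0 0).im, (M 1 0).re, (M 1 0).im⟩, ?_⟩
      ext i j
      fin_cases i <;> fin_cases j <;> simp [quatMatrix, h1, h2]
  simp only [key]
  have e00 : (finProdFinEquiv ((0 : Fin 2), (0 : Fin 2)) : Fin 4) = 0 := rfl
  have e01 : (finProdFinEquiv ((0 : Fin 2), (1 : Fin 2)) : Fin 4) = 1 := rfl
  have e10 : (finProdFinEquiv ((1 : Fin 2), (0 : Fin 2)) : Fin 4) = 2 := rfl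
  have e11 : (finProdFinEquiv ((1 : Fin 2), (1 : Fin 2)) : Fin 4) = 3 := rfl
  constructor
  · intro h
    have h00 := h 0 0
    have h01 := h 0 1
    have h10 := h 1 0
    have h11 := h 1 1
    simp only [block, Matrix.of_apply, e00, e01, e10, e11] at h00 h01 h10 h11
    ext i j
    fin_cases i <;> fin_cases j <;>
      simp [jMatrix, Matrix.mul_apply, Fin.sum_univ_four, h00, h01, h10, h11]
  · intro h a b
    have h' : ∀ i j, (T * jMatrix) i j = (jMatrix * T.map (starRingEnd ℂ)) i j := by
      intro i j
      rw [h]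
    simp [jMatrix, Matrix.mul_apply, Fin.sum_univ_four, Fin.forall_fin_succ] at h'
    fin_cases a <;> fin_cases b <;> simp [block, e00, e01, e10, e11] <;> grind

/-- `GL(2, ℍ)`, as the subgroup of `GL(4, ℂ)` of all invertible matrices with four quaternionic
blocks. -/
def GL2H : Subgroup (Matrix.GeneralLinearGroup (Fin 4) ℂ) where
  carrier := {T | ∀ a b, block (T : Matrix (Fin 4) (Fin 4) ℂ) a b ∈ Set.range quatMatrix}
  mul_mem' := by
    intro S T hS hT
    simp only [Set.mem_ofPred_eq, block_mem_iff, Units.val_mul] at hS hT ⊢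
    rw [Matrix.map_mul, Matrix.mul_assoc, hT, ← Matrix.mul_assoc, hS, Matrix.mul_assoc]
  one_mem' := by
    simp only [Set.mem_ofPred_eq, block_mem_iff, Units.val_one]
    simp
  inv_mem' := by
    intro T hT
    simp only [Set.mem_ofPred_eq, block_mem_iff] at hT ⊢
    have h1 : (T : Matrix (Fin 4) (Fin 4) ℂ).map (starRingEnd ℂ) *
        ((T⁻¹ : Matrix.GeneralLinearGroup (Fin 4) ℂ) : Matrix (Fin 4) (Fin 4) ℂ).map
          (starRingEnd ℂ) = 1 := by
      rw [← Matrix.map_mul, ← Units.val_mul, mul_inv_cancel]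
      simp
    have h2 : ((T⁻¹ : Matrix.GeneralLinearGroup (Fin 4) ℂ) : Matrix (Fin 4) (Fin 4) ℂ) *
        (T : Matrix (Fin 4) (Fin 4) ℂ) = 1 := by
      rw [← Units.val_mul, inv_mul_cancel, Units.val_one]
    calc _ = (T⁻¹).val * (jMatrix * (T.val.map (starRingEnd ℂ) *
              (T⁻¹).val.map (starRingEnd ℂ))) := by rw [h1, Matrix.mul_one]
      _ = (T⁻¹).val * (T.val * jMatrix) * (T⁻¹).val.map (starRingEnd ℂ) := by
          rw [hT]; simp only [Matrix.mul_assoc]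
      _ = _ := by rw [← Matrix.mul_assoc, h2, Matrix.one_mul]

/-- The subgroup `{r I₄ : r ∈ ℝˣ}` of `GL(2, ℍ)`. -/
def realScalars : Subgroup GL2H where
  carrier := {T | ∃ r : ℝˣ, (T.1 : Matrix (Fin 4) (Fin 4) ℂ) = ((r : ℝ) : ℂ) • 1}
  mul_mem' := by
    rintro S T ⟨r, hr⟩ ⟨s, hs⟩
    refine ⟨r * s, ?_⟩
    change S.1.val * T.1.val = _
    rw [hr, hs, Matrix.smul_mul, Matrix.one_mul, smul_smul, Units.val_mul, Complex.ofReal_mul]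
  one_mem' := ⟨1, by simp⟩
  inv_mem' := by
    rintro T ⟨r, hr⟩
    refine ⟨r⁻¹, ?_⟩
    have h : (T.1⁻¹).val * T.1.val = 1 := by
      rw [← Units.val_mul, inv_mul_cancel, Units.val_one]
    rw [hr, Matrix.mul_smul, Matrix.mul_one] at h
    have hr0 : ((r : ℝ) : ℂ) ≠ 0 := by exact_mod_cast r.ne_zero
    change (T.1⁻¹).val = _
    rw [← h, smul_smul]
    simp [hr0]

instance realScalars_normal : realScalars.Normal where
  conj_mem := by
    rintro S ⟨r, hr⟩ T
    refine ⟨r, ?_⟩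
    have h : T.1.val * (T.1⁻¹).val = 1 := by
      rw [← Units.val_mul, mul_inv_cancel, Units.val_one]
    change T.1.val * S.1.val * (T.1⁻¹).val = _
    rw [hr, Matrix.mul_smul, Matrix.mul_one, Matrix.smul_mul, h]

/-- `PGL(2, ℍ) = GL(2, ℍ) / ℝˣ`. -/
abbrev PGL2H : Type := GL2H ⧸ realScalars

/-! ### The space `Λ²ℂ⁴` and its Plücker coordinates -/

/-- The complex vector space `Λ²ℂ⁴`. -/
abbrev Wedge : Type := ⋀[ℂ]^2 (Fin 4 → ℂ)

/-- `e_a ∧ e_b`, where `e₀, …, e₃` is the standard basis of `ℂ⁴`. -/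
def wedge (a b : Fin 4) : Wedge :=
  exteriorPower.ιMulti ℂ 2 ![(Pi.single a 1 : Fin 4 → ℂ), Pi.single b 1]

/-- The vectors `E₁ = e₃ ∧ e₄`, `E₂ = -e₂ ∧ e₄`, `E₃ = e₂ ∧ e₃`, `E₄ = e₁ ∧ e₄`,
`E₅ = -e₁ ∧ e₃`, `E₆ = e₁ ∧ e₂` (all indices shifted by one). -/
def E : Fin 6 → Wedge :=
  ![wedge 2 3, -wedge 1 3, wedge 1 2, wedge 0 3, -wedge 0 2, wedge 0 1]

/-- The linear form `u ∧ v ↦ u_a v_b - u_b v_a` on `Λ²ℂ⁴`. -/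
def minor (a b : Fin 4) : Wedge →ₗ[ℂ] ℂ :=
  exteriorPower.pairingDual ℂ (Fin 4 → ℂ) 2
    (exteriorPower.ιMulti ℂ 2 ![LinearMap.proj a, LinearMap.proj b])

theorem minor_wedge (a b c d : Fin 4) :
    minor a b (wedge c d) =
      (if c = a then 1 else 0) * (if d = b then 1 else 0) -
        (if c = b then 1 else 0) * (if d = a then 1 else 0) := by
  simp only [minor, wedge, exteriorPower.pairingDual_ιMulti_ιMulti, Matrix.det_fin_two]
  simp [Pi.single_apply, eq_comm]

theorem E_linearIndependent : LinearIndependent ℂ E := by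
  refine LinearIndependent.of_pairwise_dual_eq_zero_one _
    ![minor 2 3, -minor 1 3, minor 1 2, minor 0 3, -minor 0 2, minor 0 1] ?_ ?_
  · intro i j hij
    fin_cases i <;> fin_cases j <;> first | exact absurd rfl hij | simp [E, minor_wedge]
  · intro i
    fin_cases i <;> simp [E, minor_wedge]

/-- The basis `(E₁, …, E₆)` of `Λ²ℂ⁴`. -/
def EBasis : Module.Basis (Fin 6) ℂ Wedge :=
  basisOfLinearIndependentOfCardEqFinrank E_linearIndependent (by
    rw [exteriorPower.finrank_eq]; simp [Nat.choose])

/-- The linear coordinates `ζ₁, …, ζ₆` (indices shifted by one) on `Λ²ℂ⁴`. -/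
def ζ (i : Fin 6) : Module.Dual ℂ Wedge := EBasis.coord i

/-- The vector of `Λ²ℂ⁴` with coordinates `c`. -/
def ofCoords (c : Fin 6 → ℂ) : Wedge := EBasis.equivFun.symm c

theorem ζ_ofCoords (c : Fin 6 → ℂ) (i : Fin 6) : ζ i (ofCoords c) = c i := by
  have h := congrFun (EBasis.equivFun.apply_symm_apply c) i
  simpa [ζ, ofCoords] using h

/-- The Plücker quadratic form `q(ζ) = ζ₁ζ₆ - ζ₂ζ₅ + ζ₃ζ₄`. -/
def q (p : Wedge) : ℂ := ζ 0 p * ζ 5 p - ζ 1 p * ζ 4 p + ζ 2 p * ζ 3 p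

/-- The Klein quadric `{[p] : q(p) = 0}`. -/
def kleinQuadric : Set (ℙ ℂ Wedge) := {x | q x.rep = 0}

/-! ### The actions of `PGL(2, ℍ)` -/

/-- The representation `Λ²` of `GL(2, ℍ) ⊆ GL(4, ℂ)` on `Λ²ℂ⁴`. -/
def wedgeRep : Representation ℂ GL2H Wedge where
  toFun T := exteriorPower.map 2 (Matrix.toLin' (T.1 : Matrix (Fin 4) (Fin 4) ℂ))
  map_one' := by
    simp [Module.End.one_eq_id]
  map_mul' S T := by
    rw [Subgroup.coe_mul, Units.val_mul, Matrix.toLin'_mul, Module.End.mul_eq_comp,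
      exteriorPower.map_comp]

/-- The projective action of a group attached to a linear representation. -/
def projHom {G W : Type} [Group G] [AddCommGroup W] [Module ℂ W] (ρ : Representation ℂ G W) :
    G →* Equiv.Perm (ℙ ℂ W) :=
  (MulAction.toPermHom (LinearMap.GeneralLinearGroup ℂ W) (ℙ ℂ W)).comp ρ.asGroupHom

theorem projHom_mk {G W : Type} [Group G] [AddCommGroup W] [Module ℂ W]
    (ρ : Representation ℂ G W) (g : G) (v : W) (hv : v ≠ 0) (hgv : ρ g v ≠ 0) :
    projHom ρ g (Projectivization.mk ℂ v hv) = Projectivization.mk ℂ (ρ g v) hgv :=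
  rfl

theorem projHom_eq_one {G W : Type} [Group G] [AddCommGroup W] [Module ℂ W]
    (ρ : Representation ℂ G W) (g : G) (c : ℂ) (h : ∀ v, ρ g v = c • v) :
    projHom ρ g = 1 := by
  ext x
  induction x using Projectivization.ind with
  | h v hv =>
    have hgv : ρ g v ≠ 0 := by
      intro h0
      apply hv
      have := congrArg (ρ g⁻¹) h0
      simpa using this
    rw [projHom_mk ρ g v hv hgv, Equiv.Perm.one_apply, Projectivization.mk_eq_mk_iff']
    exact ⟨c, (h v).symm⟩

theorem wedgeRep_scalar (T : GL2H) (r : ℝ)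
    (hr : (T.1 : Matrix (Fin 4) (Fin 4) ℂ) = ((r : ℝ) : ℂ) • 1) (v : Wedge) :
    wedgeRep T v = ((r : ℂ) ^ 2) • v := by
  have : wedgeRep T = ((r : ℂ) ^ 2) • LinearMap.id := by
    apply exteriorPower.linearMap_ext
    ext m
    simp only [wedgeRep, MonoidHom.coe_mk, OneHom.coe_mk, hr, map_smul, Matrix.toLin'_one,
      LinearMap.compAlternatingMap_apply, exteriorPower.map_apply_ιMulti, LinearMap.smul_apply,
      LinearMap.id_apply]
    congr 1
    have := (exteriorPower.ιMulti ℂ 2 (M := Fin 4 → ℂ)).map_smul_univ (fun _ => (r : ℂ)) m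
    simpa [Function.comp_def] using this
  rw [this]
  rfl

/-- The homomorphism from `PGL(2, ℍ)` to the permutations of `ℙ(Λ²ℂ⁴)`. -/
def pointHom : PGL2H →* Equiv.Perm (ℙ ℂ Wedge) :=
  QuotientGroup.lift realScalars (projHom wedgeRep) (by
    rintro T ⟨r, hr⟩
    exact projHom_eq_one _ _ _ (wedgeRep_scalar T r hr))

/-- The homomorphism from `PGL(2, ℍ)` to the permutations of the dual projective space, given by
the contragredient representation `f ↦ f ∘ g⁻¹`. -/
def dualHom : PGL2H →* Equiv.Perm (ℙ ℂ (Module.Dual ℂ Wedge)) :=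
  QuotientGroup.lift realScalars (projHom wedgeRep.dual) (by
    intro T hT
    obtain ⟨r, hr⟩ := realScalars.inv_mem hT
    refine projHom_eq_one _ _ ((r : ℝ) ^ 2 : ℂ) fun f => ?_
    refine LinearMap.ext fun v => ?_
    change f (wedgeRep T⁻¹ v) = _
    rw [wedgeRep_scalar T⁻¹ r hr]
    simp)

/-- The natural action of `PGL(2, ℍ)` on `ℙ(Λ²ℂ⁴)`. -/
instance pointAction : MulAction PGL2H (ℙ ℂ Wedge) := MulAction.compHom _ pointHom

/-- The natural action of `PGL(2, ℍ)` on the dual projective space of hyperplanes. -/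
instance dualAction : MulAction PGL2H (ℙ ℂ (Module.Dual ℂ Wedge)) :=
  MulAction.compHom _ dualHom

/-! ### Polarity and hyperplane sections -/

/-- The polarity on vectors: `z ↦ B(z, ·)`, the covector with coordinates
`(z₆, -z₅, z₄, z₃, -z₂, z₁)`. -/
def polarForm : Wedge →ₗ[ℂ] Module.Dual ℂ Wedge :=
  (ζ 5).smulRight (ζ 0) - (ζ 4).smulRight (ζ 1) + (ζ 3).smulRight (ζ 2)
    + (ζ 2).smulRight (ζ 3) - (ζ 1).smulRight (ζ 4) + (ζ 0).smulRight (ζ 5)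

/-- `polarForm` is the polarization of `q`. -/
theorem polarForm_apply (z p : Wedge) : polarForm z p = q (z + p) - q z - q p := by
  simp [polarForm, q]
  ring

theorem polarForm_injective : Function.Injective polarForm := by
  rw [← LinearMap.ker_eq_bot, LinearMap.ker_eq_bot']
  intro z hz
  have h : ∀ i, polarForm z (ofCoords (Pi.single i 1)) = 0 := fun i => by rw [hz]; rfl
  simp only [polarForm, LinearMap.add_apply, LinearMap.sub_apply, LinearMap.smulRight_apply,
    LinearMap.smul_apply, ζ_ofCoords, smul_eq_mul] at h
  have hz' : ∀ i, ζ i z = 0 := by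
    have h0 := h 0
    have h1 := h 1
    have h2 := h 2
    have h3 := h 3
    have h4 := h 4
    have h5 := h 5
    simp at h0 h1 h2 h3 h4 h5
    intro i
    fin_cases i <;> assumption
  exact EBasis.ext_elem fun i => by simpa [ζ] using hz' i

/-- The polarity map `κ` from `ℙ(Λ²ℂ⁴)` to the dual projective space. -/
def κ : ℙ ℂ Wedge → ℙ ℂ (Module.Dual ℂ Wedge) :=
  Projectivization.map polarForm polarForm_injective

/-- The projective hyperplane defined by a point of the dual projective space. -/
def hyperplane (h : ℙ ℂ (Module.Dual ℂ Wedge)) : Set (ℙ ℂ Wedge) := {x | h.rep x.rep = 0}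

/-- The section of the Klein quadric by a hyperplane. -/
def kleinSection (h : ℙ ℂ (Module.Dual ℂ Wedge)) : Set (ℙ ℂ Wedge) :=
  kleinQuadric ∩ hyperplane h

/-! ### The list of normal forms -/

/-- The list of types: five single ones and two one-parameter families. -/
inductive PoleType : Type
  | realNull
  | nonrealIsotropic
  | realTimelike
  | realSpacelike
  | nonrealDegenerate
  | nonrealLorentzian (θ : Set.Ioo (0 : ℝ) Real.pi)
  | nonrealNegDef (l : Set.Ioo (0 : ℝ) 1)

/-- The homogeneous coordinates of the normal form of each type. -/
def PoleType.coords : PoleType → Fin 6 → ℂ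
  | .realNull => ![0, 0, 0, 0, 0, 1]
  | .nonrealIsotropic => ![-1, 0, -Complex.I, Complex.I, 0, 1]
  | .realTimelike => ![1, 0, 0, 0, 0, 1]
  | .realSpacelike => ![1, 0, 0, 0, 0, -1]
  | .nonrealDegenerate => ![0, 0, -Complex.I, Complex.I, 0, 1]
  | .nonrealLorentzian θ => ![Complex.exp ((θ : ℝ) * Complex.I), 0, 0, 0, 0, 1]
  | .nonrealNegDef l => ![1, 0, -Complex.I * (l : ℝ), Complex.I * (l : ℝ), 0, -1]

theorem PoleType.ofCoords_ne_zero (t : PoleType) : ofCoords t.coords ≠ 0 := by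
  intro h
  have h5 := ζ_ofCoords t.coords 5
  rw [h, map_zero] at h5
  cases t <;> simp [PoleType.coords] at h5

/-- The normal form of each type, a point of `ℙ(Λ²ℂ⁴)`. -/
def PoleType.pole (t : PoleType) : ℙ ℂ Wedge :=
  Projectivization.mk ℂ (ofCoords t.coords) t.ofCoords_ne_zero

end TwistorOrbits

end

open TwistorOrbits

noncomputable section

namespace TwistorOrbits
open Matrix

/-! Identify a bivector with the skew matrix `A` of its minors. Then `Λ²T` becomes the congruence `T
A Tᵀ` (`skew_wedgeRep`), `B` becomes the polarized Pfaffian, and projective orbits become classes of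
`QuatCongr` (`exists_smul_mk_iff`).

Existence (`exists_pole`): elementary quaternionic congruences bring `A` to `S ⊗ ε`, with `S` a
complex symmetric 2 × 2 matrix and `ε` the symplectic form (`exists_quatCongr_symMatrix`). Real 2 ×
2 matrices still act by `S ↦ g S gᵀ`. Either `S` is diagonal, or it has a real null vector, or a
suitable real vector taken as first basis vector makes its entries `1`, `i t` and a real number;
each case is normalized by hand.

Uniqueness (`PoleType.eq_of_quatCongr`): congruence multiplies the Pfaffian by `det T`, which is a
positive real (`exists_det_eq_of_commute`), and commutes with the real structure `sigma`. Hence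
`|B(z, z)|` and `B(z, σ z)` scale by one common positive factor. Their ratio separates all types
except real space-like and non-real degenerate, and these differ in whether `σ z` is proportional to
`z`.

For hyperplanes, `B` is preserved up to `det T`, so the polarity is equivariant. Sections reduce to
hyperplanes because a section determines its hyperplane (`kleinSection_injective`). -/

/-! ### Bivectors as skew-symmetric matrices, and the Pfaffian -/

/-- The skew-symmetric matrix of all minors. -/
def skew : Wedge →ₗ[ℂ] Matrix (Fin 4) (Fin 4) ℂ where
  toFun v := Matrix.of fun a b => minor a b v
  map_add' u v := by ext; simp
  map_smul' c v := by ext; simp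

theorem skew_apply (v : Wedge) (a b : Fin 4) : skew v a b = minor a b v := rfl

theorem minor_ιMulti (a b : Fin 4) (m : Fin 2 → Fin 4 → ℂ) :
    minor a b (exteriorPower.ιMulti ℂ 2 m) = m 0 a * m 1 b - m 0 b * m 1 a := by
  simp only [minor, exteriorPower.pairingDual_ιMulti_ιMulti, Matrix.det_fin_two]
  simp

/-- Both sides are linear in `v`, so decomposable bivectors suffice: `u ∧ v` has matrix `u vᵀ - v
uᵀ`. -/
theorem skew_wedgeRep (T : GL2H) (v : Wedge) :
    skew (wedgeRep T v) = T.1.val * skew v * T.1.valᵀ := by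
  have : skew ∘ₗ wedgeRep T =
      (LinearMap.mulLeftRight ℂ (T.1.val, T.1.valᵀ)) ∘ₗ skew := by
    apply exteriorPower.linearMap_ext
    ext m a b
    simp only [wedgeRep, MonoidHom.coe_mk, OneHom.coe_mk, LinearMap.compAlternatingMap_apply,
      LinearMap.comp_apply, exteriorPower.map_apply_ιMulti, skew_apply, minor_ιMulti,
      LinearMap.mulLeftRight_apply, Matrix.mul_apply, Matrix.transpose_apply, Matrix.toLin'_apply,
      Function.comp, Matrix.mulVec, dotProduct, Fin.sum_univ_four]
    ring
  exact LinearMap.congr_fun this v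

/-- The skew-symmetric matrix with Plücker coordinates `a, b, c, d, e, f`. -/
def skewMatrix (a b c d e f : ℂ) : Matrix (Fin 4) (Fin 4) ℂ :=
  !![0, f, -e, d; -f, 0, c, -b; e, -c, 0, a; -d, b, -a, 0]

theorem minor_self (a : Fin 4) (v : Wedge) : minor a a v = 0 := by
  have : minor a a = 0 := by
    apply exteriorPower.linearMap_ext
    ext m
    simp only [LinearMap.compAlternatingMap_apply, minor_ιMulti]
    simp
  rw [this]; rfl

theorem minor_swap (a b : Fin 4) (v : Wedge) : minor a b v = -minor b a v := by
  have : minor a b = -minor b a := by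
    apply exteriorPower.linearMap_ext
    ext m
    simp only [LinearMap.compAlternatingMap_apply, LinearMap.neg_apply, minor_ιMulti]
    ring
  rw [this]; rfl

theorem E_eq_EBasis (i : Fin 6) : EBasis i = E i := by simp [EBasis]

theorem ζ_eq_minor : ζ = ![minor 2 3, -minor 1 3, minor 1 2, minor 0 3, -minor 0 2, minor 0 1] := by
  funext i
  refine EBasis.ext fun j => ?_
  simp only [ζ, Module.Basis.coord_apply, Module.Basis.repr_self]
  rw [E_eq_EBasis]
  fin_cases i <;> fin_cases j <;> simp [E, minor_wedge]

theorem skew_eq (v : Wedge) :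
    skew v = skewMatrix (ζ 0 v) (ζ 1 v) (ζ 2 v) (ζ 3 v) (ζ 4 v) (ζ 5 v) := by
  ext i j
  fin_cases i <;> fin_cases j <;>
    simp [skewMatrix, skew_apply, ζ_eq_minor, minor_self] <;> exact minor_swap _ _ v

theorem skew_injective : Function.Injective skew := by
  intro u v h
  have h' : ∀ a b, minor a b u = minor a b v := fun a b => congrFun (congrFun h a) b
  refine EBasis.ext_elem fun i => ?_
  change ζ i u = ζ i v
  fin_cases i <;> simp [ζ_eq_minor, h']

theorem skew_ofCoords (c : Fin 6 → ℂ) :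
    skew (ofCoords c) = skewMatrix (c 0) (c 1) (c 2) (c 3) (c 4) (c 5) := by
  simp only [skew_eq, ζ_ofCoords]

/-- The polarized Pfaffian of two skew-symmetric matrices. -/
def pfaffian₂ (A B : Matrix (Fin 4) (Fin 4) ℂ) : ℂ :=
  A 0 1 * B 2 3 - A 0 2 * B 1 3 + A 0 3 * B 1 2 + A 2 3 * B 0 1 - A 1 3 * B 0 2 + A 1 2 * B 0 3

theorem polarForm_eq_pfaffian₂ (u v : Wedge) : polarForm u v = pfaffian₂ (skew u) (skew v) := by
  simp [polarForm_apply, q, skew_eq, pfaffian₂, skewMatrix]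
  ring

theorem det_four (T : Matrix (Fin 4) (Fin 4) ℂ) : T.det =
    (T 0 0 * T 1 1 - T 0 1 * T 1 0) * (T 2 2 * T 3 3 - T 2 3 * T 3 2)
    - (T 0 0 * T 1 2 - T 0 2 * T 1 0) * (T 2 1 * T 3 3 - T 2 3 * T 3 1)
    + (T 0 0 * T 1 3 - T 0 3 * T 1 0) * (T 2 1 * T 3 2 - T 2 2 * T 3 1)
    + (T 0 1 * T 1 2 - T 0 2 * T 1 1) * (T 2 0 * T 3 3 - T 2 3 * T 3 0)
    - (T 0 1 * T 1 3 - T 0 3 * T 1 1) * (T 2 0 * T 3 2 - T 2 2 * T 3 0)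
    + (T 0 2 * T 1 3 - T 0 3 * T 1 2) * (T 2 0 * T 3 1 - T 2 1 * T 3 0) := by
  rw [Matrix.det_succ_row_zero]
  simp [Fin.sum_univ_four, Matrix.det_fin_three, Fin.succAbove]
  ring

/-- This is the polarization of `Pf(T A Tᵀ) = det T · Pf A`. -/
theorem pfaffian₂_congr (T : Matrix (Fin 4) (Fin 4) ℂ) (a b c d e f a' b' c' d' e' f' : ℂ) :
    pfaffian₂ (T * skewMatrix a b c d e f * Tᵀ) (T * skewMatrix a' b' c' d' e' f' * Tᵀ) =
      T.det * pfaffian₂ (skewMatrix a b c d e f) (skewMatrix a' b' c' d' e' f') := by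
  simp [pfaffian₂, skewMatrix, Matrix.mul_apply, Fin.sum_univ_four, det_four]
  ring

/-! ### The real structure and determinants of quaternionic matrices -/

/-- The antilinear involution on skew-symmetric matrices whose fixed points are the real points. -/
def sigma (A : Matrix (Fin 4) (Fin 4) ℂ) : Matrix (Fin 4) (Fin 4) ℂ :=
  jMatrix * A.map (starRingEnd ℂ) * jMatrixᵀ

theorem sigma_skewMatrix (a b c d e f : ℂ) : sigma (skewMatrix a b c d e f) =
    skewMatrix (star a) (star e) (-star d) (-star c) (star b) (star f) := by
  ext i j
  fin_cases i <;> fin_cases j <;>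
    simp [sigma, skewMatrix, jMatrix, Matrix.mul_apply, Fin.sum_univ_four, Matrix.vecMul,
      dotProduct]

theorem sigma_smul (k : ℂ) (A : Matrix (Fin 4) (Fin 4) ℂ) : sigma (k • A) = star k • sigma A := by
  ext i j
  simp [sigma, Matrix.mul_apply, Fin.sum_univ_four]
  ring

theorem sigma_congr (T A : Matrix (Fin 4) (Fin 4) ℂ)
    (hT : T * jMatrix = jMatrix * T.map (starRingEnd ℂ)) :
    sigma (T * A * Tᵀ) = T * sigma A * Tᵀ := by
  have hT' : jMatrixᵀ * Tᵀ = (T.map (starRingEnd ℂ))ᵀ * jMatrixᵀ := by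
    rw [← Matrix.transpose_mul, hT, Matrix.transpose_mul]
  calc sigma (T * A * Tᵀ) = (jMatrix * T.map (starRingEnd ℂ)) * A.map (starRingEnd ℂ) *
        ((T.map (starRingEnd ℂ))ᵀ * jMatrixᵀ) := by
        simp only [sigma, Matrix.map_mul, Matrix.transpose_map, Matrix.mul_assoc]
    _ = _ := by rw [← hT, ← hT']; simp only [sigma, Matrix.mul_assoc]

/-- A Schur complement argument. For quaternionic blocks `A, B, C, D` with `A ≠ 0`, the complement
`D - C A⁻¹ B` is again a quaternion, and both determinants are sums of squared norms. If `A = 0`,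
the determinant is the product of the norms of `B` and `C`. -/
theorem exists_det_eq_of_commute (T : Matrix (Fin 4) (Fin 4) ℂ)
    (hT : T * jMatrix = jMatrix * T.map (starRingEnd ℂ)) (h0 : T.det ≠ 0) :
    ∃ r : ℝ, 0 < r ∧ T.det = r := by
  have h' : ∀ i j, (T * jMatrix) i j = (jMatrix * T.map (starRingEnd ℂ)) i j := by
    intro i j
    rw [hT]
  simp [jMatrix, Matrix.mul_apply, Fin.sum_univ_four, Fin.forall_fin_succ] at h'
  obtain ⟨⟨h00, h01, h02, h03⟩, ⟨h10, h11, h12, h13⟩, ⟨h20, h21, h22, h23⟩, h30, h31, h32, h33⟩ := h'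
  set z₁ := T 0 0
  set w₁ := T 1 0
  set z₂ := T 0 2
  set w₂ := T 1 2
  set z₃ := T 2 0
  set w₃ := T 3 0
  set z₄ := T 2 2
  set w₄ := T 3 2
  have e01 : T 0 1 = -star w₁ := h00
  have e11 : T 1 1 = star z₁ := h10
  have e03 : T 0 3 = -star w₂ := h02
  have e13 : T 1 3 = star z₂ := h12
  have e21 : T 2 1 = -star w₃ := h20
  have e31 : T 3 1 = star z₃ := h30
  have e23 : T 2 3 = -star w₄ := h22
  have e33 : T 3 3 = star z₄ := h32
  have ns : ∀ z : ℂ, z * star z = (Complex.normSq z : ℂ) := Complex.mul_conj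
  have hd := det_four T
  rw [e01, e11, e03, e13, e21, e31, e23, e33] at hd
  by_cases hA : Complex.normSq z₁ + Complex.normSq w₁ = 0
  · have hz : z₁ = 0 := Complex.normSq_eq_zero.1 (by
      nlinarith [Complex.normSq_nonneg z₁, Complex.normSq_nonneg w₁])
    have hw : w₁ = 0 := Complex.normSq_eq_zero.1 (by
      nlinarith [Complex.normSq_nonneg z₁, Complex.normSq_nonneg w₁])
    have hd' : T.det = ((Complex.normSq z₂ + Complex.normSq w₂) *
        (Complex.normSq z₃ + Complex.normSq w₃) : ℝ) := by
      push_cast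
      rw [hd, ← ns, ← ns, ← ns, ← ns]
      rw [hz, hw, show T 0 0 = 0 from hz, show T 1 0 = 0 from hw, star_zero]
      ring
    refine ⟨_, lt_of_le_of_ne ?_ ?_, hd'⟩
    · have := Complex.normSq_nonneg z₂
      have := Complex.normSq_nonneg w₂
      have := Complex.normSq_nonneg z₃
      have := Complex.normSq_nonneg w₃
      positivity
    · intro h
      rw [← h] at hd'
      exact h0 (by simpa using hd')
  · have hN : 0 < Complex.normSq z₁ + Complex.normSq w₁ :=
      lt_of_le_of_ne (by
        have := Complex.normSq_nonneg z₁
        have := Complex.normSq_nonneg w₁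
        positivity) (Ne.symm hA)
    set N : ℂ := z₁ * star z₁ + w₁ * star w₁ with hNdef
    have hNN : N = ((Complex.normSq z₁ + Complex.normSq w₁ : ℝ) : ℂ) := by
      push_cast
      rw [hNdef, ns, ns]
    -- `(x, y)` is the first column of `N D - C A* B`, which is `N` times the Schur complement.
    set x : ℂ := N * z₄ - (z₃ * (star z₁ * z₂ + star w₁ * w₂) - star w₃ * (z₁ * w₂ - w₁ * z₂))
    set y : ℂ := N * w₄ - (w₃ * (star z₁ * z₂ + star w₁ * w₂) + star z₃ * (z₁ * w₂ - w₁ * z₂))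
    have key : N * T.det = x * star x + y * star y := by
      rw [hd]
      simp only [x, y, hNdef, star_sub, star_add, star_mul, star_star]
      ring
    have key' : T.det = (((Complex.normSq x + Complex.normSq y) /
        (Complex.normSq z₁ + Complex.normSq w₁) : ℝ) : ℂ) := by
      rw [Complex.ofReal_div, ← hNN, eq_div_iff (by rw [hNN]; exact_mod_cast hA), mul_comm, key,
        ns, ns]
      push_cast
      rfl
    refine ⟨_, lt_of_le_of_ne ?_ ?_, key'⟩
    · have := Complex.normSq_nonneg x
      have := Complex.normSq_nonneg y
      positivity
    · intro h
      rw [← h] at key'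
      exact h0 (by simpa using key')

/-! ### Reduction to symmetric 2 × 2 matrices -/

/-- Congruence of matrices by an element of `GL(2, ℍ)`, up to a complex factor. -/
def QuatCongr (A B : Matrix (Fin 4) (Fin 4) ℂ) : Prop :=
  ∃ T : Matrix (Fin 4) (Fin 4) ℂ, T * jMatrix = jMatrix * T.map (starRingEnd ℂ) ∧ T.det ≠ 0 ∧
    ∃ k : ℂ, k ≠ 0 ∧ T * A * Tᵀ = k • B

theorem QuatCongr.trans {A B C : Matrix (Fin 4) (Fin 4) ℂ} (h₁ : QuatCongr A B)
    (h₂ : QuatCongr B C) : QuatCongr A C := by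
  obtain ⟨S, hS, hS0, k, hk, e⟩ := h₁
  obtain ⟨T, hT, hT0, l, hl, e'⟩ := h₂
  refine ⟨T * S, ?_, by simp [hS0, hT0], k * l, mul_ne_zero hk hl, ?_⟩
  · rw [Matrix.map_mul, Matrix.mul_assoc, hS, ← Matrix.mul_assoc, hT, Matrix.mul_assoc]
  · calc T * S * A * (T * S)ᵀ = T * (S * A * Sᵀ) * Tᵀ := by
          simp only [Matrix.transpose_mul, Matrix.mul_assoc]
      _ = _ := by rw [e, Matrix.mul_smul, Matrix.smul_mul, e', smul_smul]

theorem quatCongr_upper (a b c d e f z w : ℂ) :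
    QuatCongr (skewMatrix a b c d e f)
      (skewMatrix a (b - a * w) (c - a * star z) (d + a * z) (e - a * star w)
        (f + a * (z * star z + w * star w) - e * w + d * star z - z * c - star w * b)) := by
  refine ⟨!![1, 0, z, -star w; 0, 1, w, star z; 0, 0, 1, 0; 0, 0, 0, 1], ?_, ?_, 1, one_ne_zero, ?_⟩
  · ext i j
    fin_cases i <;> fin_cases j <;> simp [jMatrix, Matrix.mul_apply, Fin.sum_univ_four]
  · simp [det_four]
  · ext i j
    fin_cases i <;> fin_cases j <;>
      simp [skewMatrix, Matrix.mul_apply, Fin.sum_univ_four] <;> ring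

theorem quatCongr_lower (a b c d e f z w : ℂ) :
    QuatCongr (skewMatrix a b c d e f)
      (skewMatrix (a + b * star w + w * e - c * star z + z * d + f * (w * star w + z * star z))
        (b + f * w) (c - f * z) (d + f * star z) (e + f * star w) f) := by
  refine ⟨!![1, 0, 0, 0; 0, 1, 0, 0; z, -star w, 1, 0; w, star z, 0, 1], ?_, ?_, 1, one_ne_zero, ?_⟩
  · ext i j
    fin_cases i <;> fin_cases j <;> simp [jMatrix, Matrix.mul_apply, Fin.sum_univ_four]
  · simp [det_four]
  · ext i j
    fin_cases i <;> fin_cases j <;>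
      simp [skewMatrix, Matrix.mul_apply, Fin.sum_univ_four] <;> ring

theorem quatCongr_diag (a b c d e f x y : ℂ) (h : x * star x + y * star y ≠ 0) :
    QuatCongr (skewMatrix a b c d e f)
      (skewMatrix (a * (x * star x + y * star y)) (b * star x - c * y) (c * x + b * star y)
        (d * star x - e * y) (e * x + d * star y) f) := by
  refine ⟨!![1, 0, 0, 0; 0, 1, 0, 0; 0, 0, x, -star y; 0, 0, y, star x], ?_, ?_, 1, one_ne_zero, ?_⟩
  · ext i j
    fin_cases i <;> fin_cases j <;> simp [jMatrix, Matrix.mul_apply, Fin.sum_univ_four]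
  · intro h0
    apply h
    simp [det_four] at h0
    simp
    linear_combination h0
  · ext i j
    fin_cases i <;> fin_cases j <;>
      simp [skewMatrix, Matrix.mul_apply, Fin.sum_univ_four] <;> ring

theorem quatCongr_smul (a b c d e f : ℂ) (hf : f ≠ 0) :
    QuatCongr (skewMatrix a b c d e f) (skewMatrix (a / f) (b / f) (c / f) (d / f) (e / f) 1) := by
  refine ⟨1, by simp, by simp, f, hf, ?_⟩
  ext i j
  fin_cases i <;> fin_cases j <;> simp [skewMatrix] <;> field_simp

/-- The Kronecker product of a symmetric `2 × 2` matrix with the standard symplectic form. -/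
def symMatrix (p w d : ℂ) : Matrix (Fin 4) (Fin 4) ℂ := skewMatrix d 0 (-w) w 0 p

/-- For real `g`, the matrix `g ⊗ I₂` has quaternionic blocks and sends `S ⊗ ε` to `(g S gᵀ) ⊗ ε`.
Here `(x, y)` and `(z, t)` are the rows of `g`. -/
theorem quatCongr_symMatrix {p w d p' w' d' : ℂ} (x y z t : ℝ) (k : ℂ) (hdet : x * t - y * z ≠ 0)
    (hk : k ≠ 0) (hp : x ^ 2 * p + 2 * x * y * w + y ^ 2 * d = k * p')
    (hw : x * z * p + (x * t + y * z) * w + y * t * d = k * w')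
    (hd : z ^ 2 * p + 2 * z * t * w + t ^ 2 * d = k * d') :
    QuatCongr (symMatrix p w d) (symMatrix p' w' d') := by
  refine ⟨!![(x : ℂ), 0, y, 0; 0, x, 0, y; z, 0, t, 0; 0, z, 0, t], ?_, ?_, k, hk, ?_⟩
  · ext i j
    fin_cases i <;> fin_cases j <;> simp [jMatrix, Matrix.mul_apply, Fin.sum_univ_four]
  · have : ((x * t - y * z : ℝ) : ℂ) ^ 2 ≠ 0 := pow_ne_zero 2 (by exact_mod_cast hdet)
    intro h0
    apply this
    simp [det_four] at h0
    push_cast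
    linear_combination h0
  · ext i j
    fin_cases i <;> fin_cases j <;>
      simp [symMatrix, skewMatrix, Matrix.mul_apply, Fin.sum_univ_four] <;>
      first
        | ring1
        | linear_combination hp
        | linear_combination -hp
        | linear_combination hw
        | linear_combination -hw
        | linear_combination hd
        | linear_combination -hd

/-- After an upper unipotent congruence the last coordinate is a polynomial in `z, w` and their
conjugates whose coefficients are, up to sign, all six coordinates. If it vanished identically, so
would the matrix; the seven values below suffice to see this. -/
theorem exists_quatCongr_one {a b c d e f : ℂ} (h : skewMatrix a b c d e f ≠ 0) :
    ∃ a' b' c' d' e' : ℂ,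
      QuatCongr (skewMatrix a b c d e f) (skewMatrix a' b' c' d' e' 1) := by
  by_cases hz : ∃ z w : ℂ,
      f + a * (z * star z + w * star w) - e * w + d * star z - z * c - star w * b ≠ 0
  · obtain ⟨z, w, hzw⟩ := hz
    exact ⟨_, _, _, _, _, (quatCongr_upper a b c d e f z w).trans (quatCongr_smul _ _ _ _ _ _ hzw)⟩
  · exfalso
    push Not at hz
    have h0 := hz 0 0
    have h1 := hz 1 0
    have h2 := hz (-1) 0
    have h3 := hz Complex.I 0
    have h4 := hz 0 1
    have h5 := hz 0 (-1)
    have h6 := hz 0 Complex.I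
    simp at h0 h1 h2 h3 h4 h5 h6
    have I0 := Complex.I_ne_zero
    have ha : a = 0 := by linear_combination (h1 + h2) / 2 - h0
    have hf : f = 0 := h0
    subst ha hf
    have hc : c = 0 := by
      have : Complex.I * c = 0 := by linear_combination -(Complex.I * h1 + h3) / 2
      simpa using this
    have hb : b = 0 := by
      have : Complex.I * b = 0 := by linear_combination (h6 - Complex.I * h4) / 2
      simpa using this
    have hd : d = 0 := by linear_combination h1 + hc
    have he : e = 0 := by linear_combination -h4 - hb
    subst hc hb hd he
    apply h
    ext i j
    fin_cases i <;> fin_cases j <;> simp [skewMatrix]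

theorem exists_quatCongr_symMatrix {a b c d e f : ℂ} (h : skewMatrix a b c d e f ≠ 0) :
    ∃ d', QuatCongr (skewMatrix a b c d e f) (symMatrix 1 0 d') ∨
      QuatCongr (skewMatrix a b c d e f) (symMatrix 1 Complex.I d') := by
  obtain ⟨a, b, c, d, e, h1⟩ := exists_quatCongr_one h
  -- With last coordinate 1, a lower unipotent congruence shifts the four middle coordinates by any
  -- `sigma`-fixed vector. This choice removes their `sigma`-fixed part, leaving `d = c̄`, `e =
  -- -b̄`.
  have h2 := h1.trans (quatCongr_lower a b c d e 1 ((c - star d) / 2) (-(star e + b) / 2))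
  generalize (_ : ℂ) + 1 * _ = a' at h2
  set b' := b + 1 * (-(star e + b) / 2) with hb'
  set c' := c - 1 * ((c - star d) / 2) with hc'
  have hd' : d + 1 * star ((c - star d) / 2) = star c' := by
    simp [hc']
    ring
  have he' : e + 1 * star (-(star e + b) / 2) = -star b' := by
    simp [hb']
    ring
  rw [hd', he'] at h2
  by_cases hN : b' * star b' + c' * star c' = 0
  · have hbc : b' = 0 ∧ c' = 0 := by
      have : Complex.normSq b' + Complex.normSq c' = 0 := by
        have := Complex.mul_conj b'
        have := Complex.mul_conj c'
        apply Complex.ofReal_injective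
        push_cast
        simp only [Complex.star_def] at hN
        simp_all
      have hb := Complex.normSq_nonneg b'
      have hc := Complex.normSq_nonneg c'
      exact ⟨Complex.normSq_eq_zero.1 (by linarith), Complex.normSq_eq_zero.1 (by linarith)⟩
    refine ⟨a', Or.inl ?_⟩
    simpa [symMatrix, hbc.1, hbc.2] using h2
  · set N := b' * star b' + c' * star c' with hNdef
    have hNs : star N = N := by simp [hNdef, mul_comm]
    have hx : star (-Complex.I * star c' / N) = Complex.I * c' / N := by
      simp only [star_div₀, hNs]
      simp
    have hy : star (Complex.I * b' / N) = -Complex.I * star b' / N := by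
      simp only [star_div₀, hNs]
      simp
    -- The remaining middle part is determined by one quaternion, nonzero here. The lower block is
    -- chosen to turn it into `(0, -i, i, 0)`.
    have h3 := h2.trans (quatCongr_diag a' b' c' (star c') (-star b') 1 (-Complex.I * star c' / N)
      (Complex.I * b' / N) ?_)
    · rw [hx, hy] at h3
      have e1 : b' * (Complex.I * c' / N) - c' * (Complex.I * b' / N) = 0 := by ring
      have e2 : c' * (-Complex.I * star c' / N) + b' * (-Complex.I * star b' / N) =
          -Complex.I := by
        field_simp
        linear_combination -Complex.I * hNdef
      have e3 : star c' * (Complex.I * c' / N) - -star b' * (Complex.I * b' / N) =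
          Complex.I := by
        field_simp
        linear_combination -Complex.I * hNdef
      have e4 : -star b' * (-Complex.I * star c' / N) + star c' * (-Complex.I * star b' / N) =
          0 := by ring
      rw [e1, e2, e3, e4] at h3
      exact ⟨_, Or.inr h3⟩
    · rw [hx, hy]
      have : -Complex.I * star c' / N * (Complex.I * c' / N) +
          Complex.I * b' / N * (-Complex.I * star b' / N) = 1 / N := by
        field_simp
        rw [Complex.I_sq]
        linear_combination -hNdef
      rw [this]
      exact one_div_ne_zero hN


/-! ### Complex binary quadratic forms under real substitutions -/

theorem skew_nonrealLorentzian (θ : Set.Ioo (0 : ℝ) Real.pi) :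
    skew (ofCoords (PoleType.nonrealLorentzian θ).coords) =
      symMatrix 1 0 (Complex.exp ((θ : ℝ) * Complex.I)) := by
  simp [skew_ofCoords, PoleType.coords, symMatrix]

theorem skew_nonrealNegDef (l : Set.Ioo (0 : ℝ) 1) :
    skew (ofCoords (PoleType.nonrealNegDef l).coords) =
      symMatrix (-1) (Complex.I * (l : ℝ)) 1 := by
  simp [skew_ofCoords, PoleType.coords, symMatrix]

theorem exists_pole_of_diagonal {p d : ℂ} (h : p ≠ 0) :
    ∃ t : PoleType, QuatCongr (symMatrix p 0 d) (skew (ofCoords t.coords)) := by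
  suffices H : ∀ d : ℂ, ∃ t : PoleType,
      QuatCongr (symMatrix 1 0 d) (skew (ofCoords t.coords)) by
    obtain ⟨t, ht⟩ := H (d / p)
    refine ⟨t, (quatCongr_symMatrix 1 0 0 1 p (by simp) h ?_ ?_ ?_).trans ht⟩
    · simp
    · simp
    · simp
      field_simp
  intro d
  by_cases hd : d = 0
  · refine ⟨.realNull, ?_⟩
    have : skew (ofCoords PoleType.realNull.coords) = symMatrix 1 0 0 := by
      simp [skew_ofCoords, PoleType.coords, symMatrix]
    rw [this, hd]
    exact quatCongr_symMatrix 1 0 0 1 1 (by simp) one_ne_zero (by simp) (by simp) (by simp)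
  have hr : 0 < ‖d‖ := norm_pos_iff.2 hd
  have hs : Real.sqrt ‖d‖ ≠ 0 := (Real.sqrt_pos.2 hr).ne'
  have h1 : QuatCongr (symMatrix 1 0 d) (symMatrix 1 0 (Complex.exp (d.arg * Complex.I))) := by
    refine quatCongr_symMatrix 1 0 0 (1 / Real.sqrt ‖d‖) 1 (by simpa using hs) one_ne_zero
      (by simp) (by simp) ?_
    have hss : ((Real.sqrt ‖d‖ : ℝ) : ℂ) ^ 2 = (‖d‖ : ℂ) := by
      exact_mod_cast Real.sq_sqrt hr.le
    have hs' : ((Real.sqrt ‖d‖ : ℝ) : ℂ) ≠ 0 := by exact_mod_cast hs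
    push_cast
    field_simp
    rw [hss]
    simp
  rcases lt_trichotomy d.arg 0 with ha | ha | ha
  · refine ⟨.nonrealLorentzian ⟨-d.arg, by linarith, by
      have := Complex.neg_pi_lt_arg d; linarith⟩, h1.trans ?_⟩
    rw [skew_nonrealLorentzian]
    have e0 := Complex.exp_ne_zero (d.arg * Complex.I)
    -- Exchanging the basis vectors and dividing by the phase changes the sign of the angle.
    refine quatCongr_symMatrix 0 1 1 0 (Complex.exp (d.arg * Complex.I)) (by simp) e0
      (by simp) (by simp) ?_
    rw [← Complex.exp_add]
    simp
  · refine ⟨.realTimelike, ?_⟩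
    have : skew (ofCoords PoleType.realTimelike.coords) = symMatrix 1 0 1 := by
      simp [skew_ofCoords, PoleType.coords, symMatrix]
    rw [this]
    simpa [ha] using h1
  · rcases (Complex.arg_le_pi d).lt_or_eq with hb | hb
    · refine ⟨.nonrealLorentzian ⟨d.arg, ha, hb⟩, ?_⟩
      rw [skew_nonrealLorentzian]
      exact h1
    · refine ⟨.realSpacelike, h1.trans ?_⟩
      have : skew (ofCoords PoleType.realSpacelike.coords) = symMatrix (-1) 0 1 := by
        simp [skew_ofCoords, PoleType.coords, symMatrix]
      rw [this, hb, Complex.exp_pi_mul_I]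
      exact quatCongr_symMatrix 1 0 0 1 (-1) (by simp) (by simp) (by simp) (by simp) (by simp)

/-- The hypothesis says that the real vector `(x, 1)` is null for the form. -/
theorem quatCongr_nonrealDegenerate {d : ℂ} (x : ℝ) (hd : (x : ℂ) ^ 2 + 2 * Complex.I * x + d = 0) :
    QuatCongr (symMatrix 1 Complex.I d) (skew (ofCoords PoleType.nonrealDegenerate.coords)) := by
  have : skew (ofCoords PoleType.nonrealDegenerate.coords) = symMatrix 1 Complex.I 0 := by
    simp [skew_ofCoords, PoleType.coords, symMatrix]
  rw [this]
  have hx : (0 : ℝ) < 1 + x ^ 2 := by positivity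
  have hxc : (1 + x ^ 2 : ℂ) ≠ 0 := by exact_mod_cast hx.ne'
  have hd' : d = -(x ^ 2 + 2 * Complex.I * x) := by linear_combination hd
  -- The second row is `(x, 1) / (1 + x²)`. The first is `(1, 0)` minus the multiple of `(x, 1)`
  -- that makes its value equal to the scale factor `k`.
  refine quatCongr_symMatrix (1 - x ^ 2 / (2 * (1 + x ^ 2))) (-x / (2 * (1 + x ^ 2)))
    (x / (1 + x ^ 2)) (1 / (1 + x ^ 2)) ((1 - Complex.I * x) / (1 + x ^ 2)) ?_ ?_ ?_ ?_ ?_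
  · have : (1 - x ^ 2 / (2 * (1 + x ^ 2))) * (1 / (1 + x ^ 2)) -
        -x / (2 * (1 + x ^ 2)) * (x / (1 + x ^ 2)) = 1 / (1 + x ^ 2) := by
      field_simp
      ring
    rw [this]
    exact one_div_ne_zero hx.ne'
  · refine div_ne_zero (fun h => ?_) hxc
    simpa using congrArg Complex.re h
  all_goals
    rw [hd']
    push_cast
    field_simp
    ring_nf
    try rw [Complex.I_sq]
    try ring

theorem exists_pole_of_real (d : ℝ) :
    ∃ t : PoleType, QuatCongr (symMatrix 1 Complex.I d) (skew (ofCoords t.coords)) := by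
  rcases lt_trichotomy d 0 with hd | hd | hd
  · obtain ⟨s, hs, rfl⟩ : ∃ s : ℝ, 0 < s ∧ d = -s ^ 2 :=
      ⟨Real.sqrt (-d), Real.sqrt_pos.2 (by linarith), by rw [Real.sq_sqrt (by linarith)]; ring⟩
    have hs' : (s : ℂ) ≠ 0 := by exact_mod_cast hs.ne'
    rcases lt_trichotomy s 1 with h1 | h1 | h1
    · refine ⟨.nonrealNegDef ⟨s, hs, h1⟩, ?_⟩
      rw [skew_nonrealNegDef]
      -- The vectors `(s, 1)` and `(s, -1)` have values `±2 i s` and mutual product `2 s²`.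
      refine quatCongr_symMatrix s 1 s (-1) (-2 * Complex.I * s) ?_ ?_ ?_ ?_ ?_
      · intro h
        linarith
      · simp [hs.ne']
      · push_cast
        ring
      · push_cast
        ring_nf
        rw [Complex.I_sq]
        ring
      · push_cast
        ring
    · refine ⟨.nonrealIsotropic, ?_⟩
      have : skew (ofCoords PoleType.nonrealIsotropic.coords) = symMatrix 1 Complex.I (-1) := by
        simp [skew_ofCoords, PoleType.coords, symMatrix]
      rw [this, h1]
      exact quatCongr_symMatrix 1 0 0 1 1 (by simp) (by simp) (by simp) (by simp) (by simp)
    · refine ⟨.nonrealNegDef ⟨1 / s, by positivity, by rw [div_lt_one hs]; exact h1⟩, ?_⟩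
      rw [skew_nonrealNegDef]
      -- Rescaling the second vector replaces `s` by `1 / s`, so the parameter falls below 1.
      refine quatCongr_symMatrix 1 0 0 (-1 / s) (-1) ?_ (by simp) (by simp) ?_ ?_
      · simpa using hs.ne'
      · push_cast
        simp
        ring
      · push_cast
        field_simp
        ring
  · exact ⟨_, quatCongr_nonrealDegenerate 0 (by simp [hd])⟩
  · obtain ⟨s, hs, rfl⟩ : ∃ s : ℝ, 0 < s ∧ d = s ^ 2 :=
      ⟨Real.sqrt d, Real.sqrt_pos.2 hd, by rw [Real.sq_sqrt hd.le]⟩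
    -- The real vectors `(s, 1)` and `(-s, 1)` are orthogonal for this form and diagonalize it.
    obtain ⟨t, ht⟩ := exists_pole_of_diagonal (p := 2 * s ^ 2 + 2 * Complex.I * s)
      (d := 2 * s ^ 2 - 2 * Complex.I * s) (fun h => by
        have := congrArg Complex.im h
        simp [← Complex.ofReal_pow] at this
        exact hs.ne' this)
    refine ⟨t, (quatCongr_symMatrix s 1 (-s) 1 1 ?_ one_ne_zero ?_ ?_ ?_).trans ht⟩
    · intro h
      linarith
    all_goals
      push_cast
      ring

/-- Here `c` is a square root of the determinant `d + 1` of the form. The point is a real vector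
`(x, 1)` whose value has the same phase as `c` up to sign, or is zero, or `c = 0`. The condition on
`x` is real and of degree at most two. -/
theorem exists_real_root (d : ℂ) : ∃ (x : ℝ) (c : ℂ), c ^ 2 = d + 1 ∧
    ((x ^ 2 + 2 * Complex.I * x + d) * star c).im = 0 := by
  obtain ⟨c, hc⟩ := IsAlgClosed.exists_pow_nat_eq (d + 1) (n := 2) (by norm_num)
  have h1 := congrArg Complex.re hc
  have h2 := congrArg Complex.im hc
  simp [pow_two] at h1 h2
  have key : ∀ x : ℝ, (((x : ℂ) ^ 2 + 2 * Complex.I * x + d) * star c).im =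
      (2 * x + d.im) * c.re - (x ^ 2 + d.re) * c.im := by
    intro x
    simp [pow_two]
    ring
  by_cases hc2 : c.im = 0
  · exact ⟨-d.im / 2, c, hc, (key _).trans (by rw [hc2]; ring)⟩
  -- This is a quarter of the discriminant after substituting `d = c² - 1`; it is a sum of squares.
  · have hD : 0 ≤ c.re ^ 2 + c.im ^ 2 + c.re ^ 2 * c.im ^ 2 + c.im ^ 4 := by positivity
    have hs := Real.sq_sqrt hD
    set s := Real.sqrt (c.re ^ 2 + c.im ^ 2 + c.re ^ 2 * c.im ^ 2 + c.im ^ 4)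
    refine ⟨(c.re + s) / c.im, c, hc, (key _).trans ?_⟩
    have e1 : d.re = c.re * c.re - c.im * c.im - 1 := by linarith
    have e2 : d.im = c.re * c.im + c.im * c.re := by linarith
    rw [e1, e2]
    field_simp
    linear_combination -hs

theorem exists_pole_of_symMatrix (d : ℂ) :
    ∃ t : PoleType, QuatCongr (symMatrix 1 Complex.I d) (skew (ofCoords t.coords)) := by
  obtain ⟨x, c, hc, him⟩ := exists_real_root d
  set f : ℂ := x ^ 2 + 2 * Complex.I * x + d with hf
  by_cases hf0 : f = 0
  · exact ⟨_, quatCongr_nonrealDegenerate x hf0⟩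
  obtain ⟨r, hr⟩ : ∃ r : ℝ, c = r * f := by
    refine ⟨(f * star c).re / Complex.normSq f, ?_⟩
    have h1 : (((f * star c).re : ℝ) : ℂ) = star f * c := by
      rw [← Complex.conj_eq_iff_re.1 (Complex.conj_eq_iff_im.2 him), Complex.ofReal_re,
        Complex.conj_eq_iff_re.1 (Complex.conj_eq_iff_im.2 him)]
      have := Complex.conj_eq_iff_im.2 him
      rw [← this]
      simp
    have h2 : ((Complex.normSq f : ℝ) : ℂ) = f * star f := (Complex.mul_conj f).symm
    have h3 : star f ≠ 0 := star_ne_zero.2 hf0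
    push_cast
    rw [h1, h2]
    field_simp
  set w : ℂ := -(x + Complex.I) / f with hw
  have hwf : w * f = -(x + Complex.I) := by rw [hw]; field_simp
  -- Taking `(x, 1)` as first basis vector and dividing by `f` gives a form with determinant `(d +
  -- 1) / f² = r²`, which is real.
  have hw2 : 1 / f = w ^ 2 + r ^ 2 := by
    have : (1 / f) * f ^ 2 = (w ^ 2 + r ^ 2) * f ^ 2 := by
      have e : (w ^ 2 + r ^ 2) * f ^ 2 = (x + Complex.I) ^ 2 + (d + 1) := by
        rw [← hc, hr]
        linear_combination (w * f - (x + Complex.I)) * hwf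
      rw [e]
      field_simp
      rw [hf]
      ring_nf
      rw [Complex.I_sq]
      ring
    exact mul_right_cancel₀ (pow_ne_zero 2 hf0) this
  have h1 : QuatCongr (symMatrix 1 Complex.I d) (symMatrix 1 w (w ^ 2 + r ^ 2)) := by
    refine quatCongr_symMatrix x 1 (-1) 0 f (by simp) hf0 ?_ ?_ ?_
    · rw [hf]
      push_cast
      ring
    · push_cast
      linear_combination -hwf
    · rw [← hw2]
      push_cast
      field_simp
      ring
  have hwd : w = w.re + w.im * Complex.I := (Complex.re_add_im w).symm
  -- A real shear removes the real part of `w`, and the form acquires real diagonal and imaginary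
  -- off-diagonal entries.
  have h2 : QuatCongr (symMatrix 1 w (w ^ 2 + r ^ 2))
      (symMatrix 1 (w.im * Complex.I) ((r ^ 2 - w.im ^ 2 : ℝ) : ℂ)) := by
    generalize w.re = g at hwd
    generalize w.im = t at hwd
    refine quatCongr_symMatrix 1 0 (-g) 1 1 (by simp) one_ne_zero (by simp) ?_ ?_
    · rw [hwd]
      push_cast
      ring
    · rw [hwd]
      push_cast
      ring_nf
      rw [Complex.I_sq]
      ring
  by_cases ht : w.im = 0
  · obtain ⟨t, h3⟩ := exists_pole_of_diagonal (p := 1) (d := ((r ^ 2 - w.im ^ 2 : ℝ) : ℂ))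
      one_ne_zero
    refine ⟨t, h1.trans (h2.trans ?_)⟩
    simpa [ht] using h3
  · obtain ⟨t, h3⟩ := exists_pole_of_real ((r ^ 2 - w.im ^ 2) / w.im ^ 2)
    refine ⟨t, h1.trans (h2.trans (QuatCongr.trans ?_ h3))⟩
    have ht' : (w.im : ℂ) ≠ 0 := by exact_mod_cast ht
    refine quatCongr_symMatrix 1 0 0 (1 / w.im) 1 (by simpa using ht) one_ne_zero (by simp) ?_ ?_
    · push_cast
      field_simp
      simp
    · push_cast
      field_simp
      simp

theorem exists_pole {v : Wedge} (hv : v ≠ 0) :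
    ∃ t : PoleType, QuatCongr (skew v) (skew (ofCoords t.coords)) := by
  have h0 : skew v ≠ 0 := fun h => hv (skew_injective (by rw [h, map_zero]))
  rw [skew_eq] at h0 ⊢
  obtain ⟨d, h | h⟩ := exists_quatCongr_symMatrix h0
  · obtain ⟨t, ht⟩ := exists_pole_of_diagonal (p := 1) (d := d) one_ne_zero
    exact ⟨t, h.trans ht⟩
  · obtain ⟨t, ht⟩ := exists_pole_of_symMatrix d
    exact ⟨t, h.trans ht⟩

/-! ### Uniqueness of the normal form -/

theorem pfaffian₂_smul (k l : ℂ) (A B : Matrix (Fin 4) (Fin 4) ℂ) :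
    pfaffian₂ (k • A) (l • B) = k * l * pfaffian₂ A B := by
  simp [pfaffian₂]
  ring

/-- Twice the absolute value of the Plücker form at the normal form. -/
def PoleType.absForm : PoleType → ℝ
  | .realNull => 0
  | .nonrealIsotropic => 0
  | .realTimelike => 2
  | .realSpacelike => 2
  | .nonrealDegenerate => 2
  | .nonrealLorentzian _ => 2
  | .nonrealNegDef l => 2 * (1 - (l : ℝ) ^ 2)

/-- The Hermitian form `B(z, σ z)` at the normal form. -/
def PoleType.hermForm : PoleType → ℝ
  | .realNull => 0
  | .nonrealIsotropic => -4
  | .realTimelike => 2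
  | .realSpacelike => -2
  | .nonrealDegenerate => -2
  | .nonrealLorentzian θ => 2 * Real.cos θ
  | .nonrealNegDef l => -2 * (1 + (l : ℝ) ^ 2)

theorem PoleType.norm_pfaffian₂ (t : PoleType) :
    ‖pfaffian₂ (skew (ofCoords t.coords)) (skew (ofCoords t.coords))‖ = t.absForm := by
  cases t with
  | nonrealLorentzian θ =>
    simp only [skew_ofCoords, coords, pfaffian₂, skewMatrix, absForm]
    simp
    rw [← two_mul, norm_mul, Complex.norm_exp_ofReal_mul_I]
    simp
  | nonrealNegDef l =>
    have h : pfaffian₂ (skew (ofCoords (nonrealNegDef l).coords))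
        (skew (ofCoords (nonrealNegDef l).coords)) = ((-(2 * (1 - (l : ℝ) ^ 2)) : ℝ) : ℂ) := by
      simp [skew_ofCoords, coords, pfaffian₂, skewMatrix]
      ring_nf
      rw [Complex.I_sq]
      ring
    obtain ⟨l, h0, h1⟩ := l
    have : 0 ≤ 2 * (1 - l ^ 2) := by nlinarith
    rw [h, Complex.norm_real, norm_neg, Real.norm_of_nonneg this]
    rfl
  | _ =>
    simp [skew_ofCoords, coords, pfaffian₂, skewMatrix, absForm]
    try norm_num

theorem PoleType.pfaffian₂_sigma (t : PoleType) :
    pfaffian₂ (skew (ofCoords t.coords)) (sigma (skew (ofCoords t.coords))) = t.hermForm := by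
  rw [skew_ofCoords, sigma_skewMatrix]
  cases t with
  | nonrealLorentzian θ =>
    simp [coords, pfaffian₂, skewMatrix, hermForm, ← Complex.exp_conj, Complex.two_cos]
    try ring
  | _ =>
    simp [coords, pfaffian₂, skewMatrix, hermForm]
    try ring_nf
    try rw [Complex.I_sq]
    try ring

/-- From `T A Tᵀ = k B` follow `det T · Pf(A, A) = k² Pf(B, B)` and `det T · Pf(A, σA) = |k|² Pf(B,
σB)`. Since `det T > 0`, taking norms in the first gives the same factor `|k|² / det T` in both. -/
theorem PoleType.quatCongr_invariants {t t' : PoleType}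
    (h : QuatCongr (skew (ofCoords t.coords)) (skew (ofCoords t'.coords))) :
    (∃ s : ℝ, 0 < s ∧ t.absForm = s * t'.absForm ∧ t.hermForm = s * t'.hermForm) ∧
    ((∃ c : ℂ, sigma (skew (ofCoords t.coords)) = c • skew (ofCoords t.coords)) →
      ∃ c : ℂ, sigma (skew (ofCoords t'.coords)) = c • skew (ofCoords t'.coords)) := by
  obtain ⟨T, hT, hT0, k, hk, e⟩ := h
  obtain ⟨r, hr, hrT⟩ := exists_det_eq_of_commute T hT hT0
  have e' := sigma_congr T (skew (ofCoords t.coords)) hT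
  rw [e, sigma_smul] at e'
  have hks : star k ≠ 0 := star_ne_zero.2 hk
  constructor
  · refine ⟨‖k‖ ^ 2 / r, by positivity, ?_, ?_⟩
    · have h1 := pfaffian₂_congr T (t.coords 0) (t.coords 1) (t.coords 2) (t.coords 3) (t.coords 4)
        (t.coords 5) (t.coords 0) (t.coords 1) (t.coords 2) (t.coords 3) (t.coords 4) (t.coords 5)
      rw [← skew_ofCoords, e, pfaffian₂_smul, hrT] at h1
      have h2 := congrArg norm h1
      rw [norm_mul, norm_mul, norm_mul, t.norm_pfaffian₂, t'.norm_pfaffian₂, Complex.norm_real,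
        Real.norm_of_nonneg hr.le] at h2
      field_simp
      linarith
    · have h1 : pfaffian₂ (T * skew (ofCoords t.coords) * Tᵀ)
          (T * sigma (skew (ofCoords t.coords)) * Tᵀ) =
          T.det * pfaffian₂ (skew (ofCoords t.coords)) (sigma (skew (ofCoords t.coords))) := by
        rw [skew_ofCoords, sigma_skewMatrix, pfaffian₂_congr]
      rw [e, ← e', pfaffian₂_smul, hrT, t.pfaffian₂_sigma, t'.pfaffian₂_sigma, Complex.star_def,
        Complex.mul_conj, Complex.normSq_eq_norm_sq] at h1
      have h2 : ‖k‖ ^ 2 * t'.hermForm = r * t.hermForm := by exact_mod_cast h1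
      field_simp
      linarith
  · rintro ⟨c, hc⟩
    refine ⟨c * k / star k, ?_⟩
    rw [hc, Matrix.mul_smul, Matrix.smul_mul, e, smul_smul] at e'
    rw [div_eq_inv_mul, mul_smul, ← e', smul_smul, inv_mul_cancel₀ hks, one_smul]

theorem not_real_nonrealDegenerate (c : ℂ) :
    sigma (skew (ofCoords PoleType.nonrealDegenerate.coords)) ≠
      c • skew (ofCoords PoleType.nonrealDegenerate.coords) := by
  intro h
  rw [skew_ofCoords, sigma_skewMatrix] at h
  have h1 := congrFun (congrFun h 0) 1
  have h2 := congrFun (congrFun h 0) 3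
  simp [skewMatrix, PoleType.coords] at h1 h2
  rw [← h1] at h2
  norm_num [Complex.ext_iff] at h2

theorem real_realSpacelike :
    ∃ c : ℂ, sigma (skew (ofCoords PoleType.realSpacelike.coords)) =
      c • skew (ofCoords PoleType.realSpacelike.coords) := by
  refine ⟨1, ?_⟩
  rw [skew_ofCoords, sigma_skewMatrix]
  simp [PoleType.coords]

theorem PoleType.eq_of_quatCongr {t t' : PoleType}
    (h : QuatCongr (skew (ofCoords t.coords)) (skew (ofCoords t'.coords)))
    (h' : QuatCongr (skew (ofCoords t'.coords)) (skew (ofCoords t.coords))) : t = t' := by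
  obtain ⟨⟨s, hs, h1, h2⟩, h3⟩ := quatCongr_invariants h
  have h4 := (quatCongr_invariants h').2
  have hcos : ∀ θ : Set.Ioo (0 : ℝ) Real.pi, -1 < Real.cos θ ∧ Real.cos θ < 1 := by
    rintro ⟨θ, h0, h1⟩
    constructor
    · rw [← Real.cos_pi]
      exact Real.cos_lt_cos_of_nonneg_of_le_pi h0.le le_rfl h1
    · rw [← Real.cos_zero]
      exact Real.cos_lt_cos_of_nonneg_of_le_pi le_rfl h1.le h0
  have hsq : ∀ l : Set.Ioo (0 : ℝ) 1, 0 < (l : ℝ) ^ 2 ∧ (l : ℝ) ^ 2 < 1 := by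
    rintro ⟨l, h0, h1⟩
    exact ⟨by positivity, by nlinarith⟩
  -- Equality of the ratios, cross-multiplied because `absForm` may vanish. The ratio is `cos θ` in
  -- the Lorentzian family and `-(1 + λ²) / (1 - λ²) < -1` in the negative-definite one.
  have hQ : t.absForm * t'.hermForm = t'.absForm * t.hermForm := by rw [h1, h2]; ring
  cases t <;> cases t' <;> simp only [absForm, hermForm] at h1 h2 hQ
  case nonrealLorentzian.nonrealLorentzian θ θ' =>
    congr 1
    apply Subtype.ext
    exact Real.injOn_cos ⟨θ.2.1.le, θ.2.2.le⟩ ⟨θ'.2.1.le, θ'.2.2.le⟩ (by linarith)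
  case nonrealNegDef.nonrealNegDef l l' =>
    congr 1
    apply Subtype.ext
    exact (sq_eq_sq₀ l.2.1.le l'.2.1.le).1 (by linarith)
  case realSpacelike.nonrealDegenerate =>
    obtain ⟨c, hc⟩ := h3 real_realSpacelike
    exact absurd hc (not_real_nonrealDegenerate c)
  case nonrealDegenerate.realSpacelike =>
    obtain ⟨c, hc⟩ := h4 real_realSpacelike
    exact absurd hc (not_real_nonrealDegenerate c)
  all_goals
    first
    | rfl
    | (exfalso
       try have c1 := hcos ‹Set.Ioo (0 : ℝ) Real.pi›
       try have c2 := hsq ‹Set.Ioo (0 : ℝ) 1›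
       first
       | linarith
       | nlinarith)

/-! ### The action on points and hyperplanes -/

theorem GL2H.det_ne_zero (T : GL2H) : T.1.val.det ≠ 0 :=
  ((Matrix.isUnit_iff_isUnit_det _).1 T.1.isUnit).ne_zero

theorem wedgeRep_ne_zero (T : GL2H) {v : Wedge} (hv : v ≠ 0) : wedgeRep T v ≠ 0 := by
  intro h
  apply hv
  simpa using congrArg (wedgeRep T⁻¹) h

theorem dual_wedgeRep_ne_zero (T : GL2H) {f : Module.Dual ℂ Wedge} (hf : f ≠ 0) :
    wedgeRep.dual T f ≠ 0 := by
  intro h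
  apply hf
  rw [← Representation.inv_self_apply wedgeRep.dual T f, h, map_zero]

theorem smul_mk (T : GL2H) (v : Wedge) (hv : v ≠ 0) :
    (T : PGL2H) • Projectivization.mk ℂ v hv =
      Projectivization.mk ℂ (wedgeRep T v) (wedgeRep_ne_zero T hv) :=
  rfl

theorem smul_mk_dual (T : GL2H) (f : Module.Dual ℂ Wedge) (hf : f ≠ 0) :
    (T : PGL2H) • Projectivization.mk ℂ f hf =
      Projectivization.mk ℂ (wedgeRep.dual T f) (dual_wedgeRep_ne_zero T hf) :=
  rfl

theorem exists_smul_mk_iff (u v : Wedge) (hu : u ≠ 0) (hv : v ≠ 0) :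
    (∃ g : PGL2H, g • Projectivization.mk ℂ u hu = Projectivization.mk ℂ v hv) ↔
      QuatCongr (skew u) (skew v) := by
  constructor
  · rintro ⟨g, hg⟩
    induction g using QuotientGroup.induction_on with
    | H T =>
      rw [smul_mk, Projectivization.mk_eq_mk_iff'] at hg
      obtain ⟨a, ha⟩ := hg
      refine ⟨T.1.val, (block_mem_iff _).1 T.2, GL2H.det_ne_zero T, a, ?_, ?_⟩
      · rintro rfl
        exact wedgeRep_ne_zero T hu (by simpa using ha.symm)
      · rw [← skew_wedgeRep, ← ha, map_smul]
  · rintro ⟨T, hT, hT0, k, hk, e⟩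
    refine ⟨((⟨Matrix.GeneralLinearGroup.mkOfDetNeZero T hT0, (block_mem_iff _).2 hT⟩ : GL2H) :
      PGL2H), ?_⟩
    rw [smul_mk, Projectivization.mk_eq_mk_iff']
    refine ⟨k, skew_injective ?_⟩
    rw [skew_wedgeRep, map_smul]
    exact e.symm

theorem orbit_pole_injective {t t' : PoleType}
    (h : MulAction.orbit PGL2H t.pole = MulAction.orbit PGL2H t'.pole) : t = t' :=
  PoleType.eq_of_quatCongr
    ((exists_smul_mk_iff _ _ t.ofCoords_ne_zero t'.ofCoords_ne_zero).1
      (h ▸ MulAction.mem_orbit_self t'.pole :))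
    ((exists_smul_mk_iff _ _ t'.ofCoords_ne_zero t.ofCoords_ne_zero).1
      (h ▸ MulAction.mem_orbit_self t.pole :))

theorem exists_smul_eq_pole (p : ℙ ℂ Wedge) : ∃ (t : PoleType) (g : PGL2H), g • p = t.pole := by
  induction p using Projectivization.ind with
  | h v hv =>
    obtain ⟨t, ht⟩ := exists_pole hv
    exact ⟨t, (exists_smul_mk_iff v _ hv t.ofCoords_ne_zero).2 ht⟩

theorem existsUnique_pole (p : ℙ ℂ Wedge) :
    ∃! t : PoleType, MulAction.orbit PGL2H p = MulAction.orbit PGL2H t.pole := by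
  obtain ⟨t, g, hg⟩ := exists_smul_eq_pole p
  have h : MulAction.orbit PGL2H p = MulAction.orbit PGL2H t.pole := by
    rw [← hg, MulAction.orbit_smul]
  exact ⟨t, h, fun t' ht' => orbit_pole_injective (ht'.symm.trans h)⟩

theorem polarForm_wedgeRep (T : GL2H) (u v : Wedge) :
    polarForm (wedgeRep T u) (wedgeRep T v) = T.1.val.det * polarForm u v := by
  rw [polarForm_eq_pfaffian₂, polarForm_eq_pfaffian₂, skew_wedgeRep, skew_wedgeRep, skew_eq,
    skew_eq, pfaffian₂_congr]

theorem polarForm_self (v : Wedge) : polarForm v v = 2 * q v := by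
  simp [polarForm, q]
  ring

theorem q_wedgeRep (T : GL2H) (v : Wedge) : q (wedgeRep T v) = T.1.val.det * q v := by
  have h := polarForm_wedgeRep T v v
  rw [polarForm_self, polarForm_self] at h
  linear_combination h / 2

theorem κ_mk (v : Wedge) (hv : v ≠ 0) : κ (Projectivization.mk ℂ v hv) =
    Projectivization.mk ℂ (polarForm v) ((map_ne_zero_iff _ polarForm_injective).2 hv) :=
  rfl

/-- Invariance of `B` up to `det T` gives `B(T v, w) = det T · B(v, T⁻¹ w)`, and the factor
disappears projectively. -/
theorem κ_smul (g : PGL2H) (p : ℙ ℂ Wedge) : κ (g • p) = g • κ p := by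
  induction g using QuotientGroup.induction_on with
  | H T =>
    induction p using Projectivization.ind with
    | h v hv =>
      rw [smul_mk, κ_mk, κ_mk, smul_mk_dual, Projectivization.mk_eq_mk_iff']
      refine ⟨T.1.val.det, LinearMap.ext fun w => ?_⟩
      have h := polarForm_wedgeRep T v (wedgeRep T⁻¹ w)
      rw [Representation.self_inv_apply] at h
      exact h.symm

theorem κ_bijective : Function.Bijective κ := by
  refine ⟨Projectivization.map_injective _ polarForm_injective, fun h => ?_⟩
  induction h using Projectivization.ind with
  | h f hf =>
    obtain ⟨v, rfl⟩ := (LinearMap.injective_iff_surjective_of_finrank_eq_finrank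
      (Subspace.dual_finrank_eq (K := ℂ) (V := Wedge)).symm).1 polarForm_injective f
    have hv : v ≠ 0 := by
      rintro rfl
      exact hf (map_zero _)
    exact ⟨Projectivization.mk ℂ v hv, rfl⟩

theorem orbit_κ_eq_iff (p p' : ℙ ℂ Wedge) :
    MulAction.orbit PGL2H (κ p) = MulAction.orbit PGL2H (κ p') ↔
      MulAction.orbit PGL2H p = MulAction.orbit PGL2H p' := by
  rw [MulAction.orbit_eq_iff, MulAction.orbit_eq_iff, MulAction.mem_orbit_iff,
    MulAction.mem_orbit_iff]
  simp only [← κ_smul, κ_bijective.1.eq_iff]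

/-! ### Hyperplane sections -/

theorem mk_mem_kleinSection_iff (v : Wedge) (hv : v ≠ 0) (f : Module.Dual ℂ Wedge) (hf : f ≠ 0) :
    Projectivization.mk ℂ v hv ∈ kleinSection (Projectivization.mk ℂ f hf) ↔ q v = 0 ∧ f v = 0 := by
  obtain ⟨a, ha⟩ := Projectivization.exists_smul_eq_mk_rep ℂ v hv
  obtain ⟨b, hb⟩ := Projectivization.exists_smul_eq_mk_rep ℂ f hf
  have hq : q (a • v) = (a : ℂ) ^ 2 * q v := by
    simp [q, Units.smul_def]
    ring
  have hf' : (b • f) (a • v) = (b : ℂ) * a * f v := by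
    simp [Units.smul_def]
    ring
  change q (Projectivization.mk ℂ v hv).rep = 0 ∧
    (Projectivization.mk ℂ f hf).rep (Projectivization.mk ℂ v hv).rep = 0 ↔ _
  rw [← ha, ← hb, hq, hf']
  simp

theorem smul_mem_kleinSection (g : PGL2H) (x : ℙ ℂ Wedge) (h : ℙ ℂ (Module.Dual ℂ Wedge))
    (hx : x ∈ kleinSection h) : g • x ∈ kleinSection (g • h) := by
  induction g using QuotientGroup.induction_on with
  | H T =>
    induction x using Projectivization.ind with
    | h v hv =>
      induction h using Projectivization.ind with
      | h f hf =>
        rw [mk_mem_kleinSection_iff] at hx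
        rw [smul_mk, smul_mk_dual, mk_mem_kleinSection_iff, q_wedgeRep, hx.1, mul_zero]
        refine ⟨rfl, ?_⟩
        change f (wedgeRep T⁻¹ (wedgeRep T v)) = 0
        rw [Representation.inv_self_apply, hx.2]

theorem image_kleinSection (g : PGL2H) (h : ℙ ℂ (Module.Dual ℂ Wedge)) :
    (fun x => g • x) '' kleinSection h = kleinSection (g • h) := by
  ext x
  constructor
  · rintro ⟨y, hy, rfl⟩
    exact smul_mem_kleinSection g y h hy
  · intro hx
    refine ⟨g⁻¹ • x, ?_, smul_inv_smul g x⟩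
    simpa using smul_mem_kleinSection g⁻¹ x _ hx

theorem dual_ofCoords (f : Module.Dual ℂ Wedge) (c : Fin 6 → ℂ) :
    f (ofCoords c) = ∑ i, c i * f (EBasis i) := by
  simp [ofCoords, Module.Basis.equivFun_symm_apply]

/-- A hyperplane `f = 0` with `f E₁ ≠ 0` is spanned by the points of the Klein quadric in it. -/
theorem eq_smul_of_forall_q_eq_zero {f g : Module.Dual ℂ Wedge} (hf : f (EBasis 0) ≠ 0)
    (h : ∀ v, q v = 0 → f v = 0 → g v = 0) : g = (g (EBasis 0) / f (EBasis 0)) • f := by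
  set F : Fin 6 → ℂ := fun i => f (EBasis i) with hF
  set G : Fin 6 → ℂ := fun i => g (EBasis i) with hG
  have hF0 : F 0 ≠ 0 := hf
  -- The equation `f = 0` is solved for the first coordinate, all coordinates being scaled by `F 0`
  -- to avoid division. On this hyperplane `q` is `-F 0` times the left side of the hypothesis.
  have key : ∀ x₁ x₂ x₃ x₄ x₅ : ℂ,
      x₅ * (F 1 * x₁ + F 2 * x₂ + F 3 * x₃ + F 4 * x₄ + F 5 * x₅) +
        F 0 * (x₁ * x₄ - x₂ * x₃) = 0 →
      (G 1 * F 0 - G 0 * F 1) * x₁ + (G 2 * F 0 - G 0 * F 2) * x₂ +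
        (G 3 * F 0 - G 0 * F 3) * x₃ + (G 4 * F 0 - G 0 * F 4) * x₄ +
        (G 5 * F 0 - G 0 * F 5) * x₅ = 0 := by
    intro x₁ x₂ x₃ x₄ x₅ hx
    have h0 := h (ofCoords ![-(F 1 * x₁ + F 2 * x₂ + F 3 * x₃ + F 4 * x₄ + F 5 * x₅),
      F 0 * x₁, F 0 * x₂, F 0 * x₃, F 0 * x₄, F 0 * x₅]) ?_ ?_
    · rw [dual_ofCoords] at h0
      simp [Fin.sum_univ_succ] at h0
      simp only [hG, hF] at h0 ⊢
      linear_combination h0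
    · simp only [q, ζ_ofCoords]
      simp
      linear_combination -F 0 * hx
    · rw [dual_ofCoords]
      simp [Fin.sum_univ_succ]
      simp only [hF]
      ring
  have k1 := key 1 0 0 0 0 (by ring)
  have k2 := key 0 1 0 0 0 (by ring)
  have k3 := key 0 0 1 0 0 (by ring)
  have k4 := key 0 0 0 1 0 (by ring)
  ring_nf at k1 k2 k3 k4
  -- The fifth unit vector need not satisfy the quadratic equation, so a solution with `x₅ = 1` is
  -- used: one with only `x₄` added if `F 4 ≠ 0`, otherwise one with `x₁ = 1`.
  have k5 : G 5 * F 0 - G 0 * F 5 = 0 := by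
    by_cases h4 : F 4 = 0
    · have := key 1 0 0 (-(F 1 + F 5) / F 0) 1 (by rw [h4]; field_simp; ring)
      linear_combination this - k1 - (-(F 1 + F 5) / F 0) * k4
    · have := key 0 0 0 (-F 5 / F 4) 1 (by field_simp; ring)
      linear_combination this - (-F 5 / F 4) * k4
  refine EBasis.ext fun i => ?_
  rw [LinearMap.smul_apply, smul_eq_mul, div_mul_eq_mul_div, eq_div_iff hf]
  change G i * F 0 = G 0 * F i
  fin_cases i
  · rfl
  · change G 1 * F 0 = G 0 * F 1
    linear_combination k1
  · change G 2 * F 0 = G 0 * F 2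
    linear_combination k2
  · change G 3 * F 0 = G 0 * F 3
    linear_combination k3
  · change G 4 * F 0 = G 0 * F 4
    linear_combination k4
  · change G 5 * F 0 = G 0 * F 5
    linear_combination k5

theorem polarForm_coords_ne_zero (t : PoleType) :
    polarForm (ofCoords t.coords) (EBasis 0) ≠ 0 := by
  have h : ∀ i, ζ i (EBasis 0) = if i = 0 then 1 else 0 := fun i => by
    simp [ζ, Finsupp.single_apply, eq_comm]
  simp only [polarForm, LinearMap.add_apply, LinearMap.sub_apply, LinearMap.smulRight_apply,
    LinearMap.smul_apply, ζ_ofCoords, h]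
  cases t <;> simp [PoleType.coords]

theorem eq_of_kleinSection_κ_pole {t : PoleType} {h : ℙ ℂ (Module.Dual ℂ Wedge)}
    (he : kleinSection (κ t.pole) = kleinSection h) : h = κ t.pole := by
  induction h using Projectivization.ind with
  | h g hg =>
    rw [PoleType.pole, κ_mk] at he ⊢
    rw [Projectivization.mk_eq_mk_iff']
    refine ⟨_, (eq_smul_of_forall_q_eq_zero (g := g) (polarForm_coords_ne_zero t) ?_).symm⟩
    intro v hqv hfv
    by_cases hv : v = 0
    · rw [hv, map_zero]
    · have hmem := (mk_mem_kleinSection_iff v hv _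
        ((map_ne_zero_iff _ polarForm_injective).2 t.ofCoords_ne_zero)).2 ⟨hqv, hfv⟩
      rw [he, mk_mem_kleinSection_iff] at hmem
      exact hmem.2

theorem exists_smul_κ_pole (h : ℙ ℂ (Module.Dual ℂ Wedge)) :
    ∃ (t : PoleType) (g : PGL2H), g • κ t.pole = h := by
  obtain ⟨p, rfl⟩ := κ_bijective.2 h
  obtain ⟨t, g, hg⟩ := exists_smul_eq_pole p
  exact ⟨t, g⁻¹, by rw [← κ_smul, ← hg, inv_smul_smul]⟩

/-- A hyperplane is determined by its section of the Klein quadric. -/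
theorem kleinSection_injective : Function.Injective kleinSection := by
  intro h h' he
  -- The group moves the hyperplane to the polar of a normal form, whose coefficient on `E₁` is the
  -- last coordinate `±1`, so the nonvanishing needed above holds.
  obtain ⟨t, g, rfl⟩ := exists_smul_κ_pole h
  have : g⁻¹ • h' = κ t.pole := eq_of_kleinSection_κ_pole (by
    rw [← image_kleinSection g⁻¹ h', ← he, image_kleinSection, inv_smul_smul])
  rw [← this, smul_inv_smul]

end TwistorOrbits

end

theorem theorem3 :
    -- every orbit of points is the orbit of exactly one of the listed points
    (∀ p : ℙ ℂ Wedge, ∃! t : PoleType,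
      MulAction.orbit PGL2H p = MulAction.orbit PGL2H t.pole) ∧
    -- the polarity carries the action on points to the action on hyperplanes
    (Function.Bijective κ ∧ ∀ (g : PGL2H) (p : ℙ ℂ Wedge), κ (g • p) = g • κ p) ∧
    -- every orbit of hyperplanes is the orbit of the polar of exactly one of the listed points
    (∀ h : ℙ ℂ (Module.Dual ℂ Wedge), ∃! t : PoleType,
      MulAction.orbit PGL2H h = MulAction.orbit PGL2H (κ t.pole)) ∧
    -- every hyperplane section of the Klein quadric is equivalent to exactly one of the list
    (∀ h : ℙ ℂ (Module.Dual ℂ Wedge), ∃! t : PoleType,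
      ∃ g : PGL2H, (fun x => g • x) '' kleinSection (κ t.pole) = kleinSection h) := by
  refine ⟨existsUnique_pole, ⟨κ_bijective, κ_smul⟩, fun h => ?_, fun h => ?_⟩
  · obtain ⟨p, rfl⟩ := κ_bijective.2 h
    simp only [orbit_κ_eq_iff]
    exact existsUnique_pole p
  · obtain ⟨t, g, rfl⟩ := exists_smul_κ_pole h
    refine ⟨t, ⟨g, image_kleinSection g _⟩, ?_⟩
    rintro t' ⟨g', hg'⟩
    rw [image_kleinSection] at hg'
    have h1 := kleinSection_injective hg'
    apply orbit_pole_injective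
    rw [← orbit_κ_eq_iff, ← MulAction.orbit_smul g', h1, MulAction.orbit_smul]
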